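/- Let $G=(V,E)$ be a finite simple graph with $V\ne\emptyset$, and let $w\ge k>0$ be integers. An (oriented) separation of $G$ is a pair $(A,B)$ of subsets of $V$ with $A\cup B=V$ such that $G$ has no edge between $A\smallsetminus B$ and $B\smallsetminus A$; its inverse is $(A,B)^*=(B,A)$, its order is $|A\cap B|$, and $(A,B)\le(C,D)$ means $A\subseteq C$ and $B\supseteq D$. Let $\vec S_k$ be the set of all oriented separations of $G$ of order $<k$, and $S_k$ the set of the corresponding unoriented separations $\{A,B\}$. A star is a non-empty set $\sigma$ of oriented separations such that $r\le s^*$ for all distinct $r,s\in\sigma$. Let $\mathcal F^w_k$ be the set of all stars $\sigma\subseteq\vec S_k$ with $\bigl|\bigcap_{(A,B)\in\sigma}B\bigr|<w$. An $\mathcal F^w_k$-tangle of $S_k$ is a set $O\subseteq\vec S_k$ that contains exactly one orientation of every separation in $S_k$, is consistent (there are no $r<s$ in $\vec S_k$ with $\{r,r^*\}\ne\{s,s^*\}$ and $r^*,s\in O$), and has no subset in $\mathcal F^w_k$. An $S_k$-tree over $\mathcal F^w_k$ is a pair $(T,\alpha)$ of a finite tree $T$ with at least one edge and a map $\alpha$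 from the set of orientations $(x,y)$ of the edges $xy$ of $T$ to $\vec S_k$ such that $\alpha(y,x)=\alpha(x,y)^*$ for every edge $xy$, and $\{\alpha(x,t): xt\in E(T)\}\in\mathcal F^w_k$ for every node $t$ of $T$. A tree-decomposition $(T,(V_t)_{t\in T})$ of $G$ (with $T$ a finite tree) has width $\max_t|V_t|-1$ and adhesion $\max_{st\in E(T)}|V_s\cap V_t|$, where the adhesion is set to $|V|$ if $T$ has only one node. Then the following assertions are equivalent: (i) $G$ has an $\mathcal F^w_k$-tangle of $S_k$. (ii) $G$ has no $S_k$-tree over $\mathcal F^w_k$. (iii) $G$ has no tree-decomposition of width $<w-1$ and adhesion $<k$. -/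

import Mathlib

namespace TreeDuality

/-- A separation system: a partially ordered set of oriented separations with an
order-reversing involution. -/
class SeparationSystem (U : Type*) extends PartialOrder U where
  /-- the inverse of an oriented separation -/
  inv : U → U
  inv_inv : ∀ r, inv (inv r) = r
  inv_le_inv : ∀ r s, inv s ≤ inv r ↔ r ≤ s

section Abstract

variable {U : Type*} [SeparationSystem U]

open SeparationSystem

/-! A set of (unoriented) separations `{s, inv s}` is represented throughout by the set
`S : Set U` of all orientations of its elements, a set that is closed under `inv`. -/

/-- A star: a non-empty set of oriented separations whose distinct elements point towards
each other. -/
def IsStar (σ : Set U) : Prop :=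
  σ.Nonempty ∧ ∀ r ∈ σ, ∀ s ∈ σ, r ≠ s → r ≤ inv s

/-- `O` is consistent in `S`: there are no distinct unoriented separations
`{r, inv r} ≠ {s, inv s}` in `S` with `r < s` such that both `inv r` and `s` lie in `O`. -/
def IsConsistent (S O : Set U) : Prop :=
  ¬ ∃ r ∈ S, ∃ s ∈ S, r ≠ s ∧ r ≠ inv s ∧ r < s ∧ inv r ∈ O ∧ s ∈ O

/-- `O` is an orientation of `S`: it consists of exactly one orientation of every separation
in `S`. (A degenerate separation `s = inv s` has only one orientation.) -/
def IsOrientation (S O : Set U) : Prop :=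
  O ⊆ S ∧ ∀ s ∈ S, ∃! x, x ∈ O ∧ (x = s ∨ x = inv s)

/-- `O` avoids `F`: no subset of `O` lies in `F`. -/
def Avoids (F : Set (Set U)) (O : Set U) : Prop :=
  ∀ σ ∈ F, ¬ σ ⊆ O

/-- An `F`-tangle of `S`: a consistent orientation of `S` that avoids `F`. -/
def IsTangle (S : Set U) (F : Set (Set U)) (O : Set U) : Prop :=
  IsOrientation S O ∧ IsConsistent S O ∧ Avoids F O

/-- An `S`-tree: a finite tree with at least one edge, and a map `α` from the orientations of
its edges to `S` that commutes with inversion. -/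
structure STree (S : Set U) where
  nodes : Type
  finite_nodes : Finite nodes
  tree : SimpleGraph nodes
  isTree : tree.IsTree
  edge_nonempty : tree.edgeSet.Nonempty
  α : tree.Dart → U
  α_mem : ∀ e, α e ∈ S
  α_symm : ∀ e, α e.symm = inv (α e)

/-- The set of oriented separations associated with the node `t`: the image under `α` of the
set of all oriented edges `(x, t)` of the tree. -/
def STree.starAt {S : Set U} (τ : STree S) (t : τ.nodes) : Set U :=
  τ.α '' {e | e.snd = t}

/-- The `S`-tree is over `F`. -/
def STree.IsOver {S : Set U} (τ : STree S) (F : Set (Set U)) : Prop :=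
  ∀ t, τ.starAt t ∈ F

end Abstract

section Graph

variable {V : Type*}

/-- An oriented vertex separation `(A, B)` of the graph `G`: `A ∪ B` is the whole vertex set
and there is no edge between `A \ B` and `B \ A`. -/
@[ext]
structure VertexSep (G : SimpleGraph V) where
  A : Set V
  B : Set V
  union_eq : A ∪ B = Set.univ
  not_adj : ∀ a ∈ A \ B, ∀ b ∈ B \ A, ¬ G.Adj a b

/-- The inverse `(B, A)` of `(A, B)`. -/
def VertexSep.swap {G : SimpleGraph V} (s : VertexSep G) : VertexSep G where
  A := s.B
  B := s.A
  union_eq := by rw [Set.union_comm]; exact s.union_eq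
  not_adj := fun a ha b hb h => s.not_adj b hb a ha h.symm

/-- `(A, B) ≤ (C, D)` means `A ⊆ C` and `D ⊆ B`; the involution is `(A, B) ↦ (B, A)`. -/
instance VertexSep.instSeparationSystem (G : SimpleGraph V) :
    SeparationSystem (VertexSep G) where
  le r s := r.A ⊆ s.A ∧ s.B ⊆ r.B
  le_refl r := ⟨subset_rfl, subset_rfl⟩
  le_trans r s t h h' := ⟨h.1.trans h'.1, h'.2.trans h.2⟩
  le_antisymm r s h h' :=
    VertexSep.ext (Set.Subset.antisymm h.1 h'.1) (Set.Subset.antisymm h'.2 h.2)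
  inv := VertexSep.swap
  inv_inv _ := rfl
  inv_le_inv _ _ := ⟨fun h => ⟨h.2, h.1⟩, fun h => ⟨h.2, h.1⟩⟩

/-- The order `|A ∩ B|` of a vertex separation (used for finite graphs). -/
noncomputable def VertexSep.order {G : SimpleGraph V} (s : VertexSep G) : ℕ :=
  (s.A ∩ s.B).ncard

/-- `S_k`: the vertex separations of `G` of order less than `k`. -/
def sepsLT (G : SimpleGraph V) (k : ℕ) : Set (VertexSep G) :=
  {s | s.order < k}

/-- `F^w_k`: the stars `{(A_i, B_i) : i = 0, …, n}` in `S_k` such that the intersection of all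
the `B_i` has fewer than `w` elements. -/
def starsLT (G : SimpleGraph V) (w k : ℕ) : Set (Set (VertexSep G)) :=
  {σ | σ ⊆ sepsLT G k ∧ IsStar σ ∧ (⋂ s ∈ σ, s.B).ncard < w}

/-- A tree-decomposition of `G`, with a finite decomposition tree. -/
structure TreeDecomposition (G : SimpleGraph V) where
  nodes : Type
  finite_nodes : Finite nodes
  tree : SimpleGraph nodes
  isTree : tree.IsTree
  bag : nodes → Set V
  vertex_mem : ∀ v, ∃ t, v ∈ bag t
  edge_mem : ∀ u v, G.Adj u v → ∃ t, u ∈ bag t ∧ v ∈ bag t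
  path_inter : ∀ (t₁ t₃ : nodes) (p : tree.Walk t₁ t₃), p.IsPath →
    ∀ t₂ ∈ p.support, bag t₁ ∩ bag t₃ ⊆ bag t₂

/-- The width of a tree-decomposition: the largest size of a part, minus one. -/
noncomputable def TreeDecomposition.width {G : SimpleGraph V} (D : TreeDecomposition G) : ℤ :=
  ((⨆ t, (D.bag t).ncard : ℕ) : ℤ) - 1

open Classical in
/-- The adhesion of a tree-decomposition: the largest size of an intersection of two parts at
adjacent nodes, and `|V|` if the decomposition tree has only one node. -/
noncomputable def TreeDecomposition.adhesion {G : SimpleGraph V} (D : TreeDecomposition G) : ℕ :=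
  if Subsingleton D.nodes then Nat.card V
  else ⨆ e : D.tree.Dart, (D.bag e.fst ∩ D.bag e.snd).ncard

end Graph

end TreeDuality

namespace TreeDuality

/-! ### Abstract duality: derivations, tangles and trees over `F`. -/

section Abstract

open SeparationSystem hiding inv_inv

variable {U : Type*} [SeparationSystem U]

/-! The assertions are proved in a cycle. A tangle excludes an `S_k`-tree: each node has an incoming
edge whose label is not in `O`, two nodes must select the same edge, and then neither of its
orientations is in `O` (`STree.not_avoids`). A tree-decomposition with an edge yields an `S_k`-tree:
an edge separates the unions of the parts on its two sides (`exists_sTree`); a one-node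
decomposition is replaced by two copies of its part.

The main step builds a tangle when there is no tree-decomposition. `Derivable F P x` records a
partial tree with root edge `x` and leaves allowed in `P`; it means that every tangle containing `P`
must contain `x`. If some `x` and `inv x` are both derivable from `∅`, the two derivations unfold
into decompositions of the two sides of `x`, which are joined along an edge
(`exists_treeDecomposition_of_derivable`). Otherwise a maximal down-closed `P` deriving no such pair
is a tangle (`exists_isTangle`). That it orients every separation rests on shifting derivations
along a separation of minimum order, where submodularity keeps orders and star intersections small
(`Derivable.exists_between`). -/

theorem le_inv_comm {r s : U} : r ≤ inv s ↔ s ≤ inv r := by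
  rw [← inv_le_inv, SeparationSystem.inv_inv]

/-- The separations that can be derived from `P` by stars in `F`: those `x` for which there is a
tree over `F`, except that leaves may also be labelled from `P`, whose root edge is labelled `x`. -/
inductive Derivable (F : Set (Set U)) (P : Set U) : U → Prop
  | base {x : U} (hx : x ∈ P) : Derivable F P x
  | step {x : U} {σ : Set U} (hx : inv x ∉ σ) (hσ : insert (inv x) σ ∈ F)
      (h : ∀ y ∈ σ, Derivable F P y) : Derivable F P x

/-- No separation and its inverse can both be derived from `P`. -/
def Irreconcilable (F : Set (Set U)) (P : Set U) : Prop :=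
  ∀ x, Derivable F P x → ¬ Derivable F P (inv x)

/-- `P` is a subset of `S` that is down-closed in `S`. -/
def IsDownClosed (S P : Set U) : Prop :=
  P ⊆ S ∧ ∀ r ∈ S, ∀ s ∈ P, r ≤ s → r ∈ P

variable {F : Set (Set U)} {P Q S : Set U}

/-- When a star is reversed or shifted, `inv x` may occur among the other members; deleting it
restores the side condition of `step`. -/
theorem Derivable.of_insert {x : U} {σ : Set U} (hσ : insert (inv x) σ ∈ F)
    (h : ∀ y ∈ σ, y ≠ inv x → Derivable F P y) : Derivable F P x := by
  refine .step (σ := σ \ {inv x}) (by simp) (by simpa using hσ) fun y hy => h y hy.1 hy.2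

theorem Derivable.trans {x : U} (h : Derivable F P x) (hPQ : ∀ y ∈ P, Derivable F Q y) :
    Derivable F Q x := by
  induction h with
  | base hx => exact hPQ _ hx
  | step hx hσ _ ih => exact .step hx hσ ih

theorem Derivable.mem (hF : ∀ σ ∈ F, σ ⊆ S) (hS : ∀ s ∈ S, inv s ∈ S) (hP : P ⊆ S) {x : U}
    (h : Derivable F P x) : x ∈ S := by
  cases h with
  | base hx => exact hP hx
  | step hx hσ _ => simpa [SeparationSystem.inv_inv] using hS _ (hF _ hσ (Set.mem_insert _ _))

/-- A derivation that uses the additional leaf `r` exactly once can be re-rooted at `r`. -/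
theorem Derivable.reroot (hF : ∀ σ ∈ F, IsStar σ) {r : U} (hr : ¬ r ≤ inv r) {x : U}
    (h : Derivable F (insert r P) x) :
    Derivable F P x ∨ (r ≤ x ∧ (Derivable F P (inv x) → Derivable F P (inv r))) := by
  induction h with
  | base hx =>
    rcases hx with rfl | hx
    · exact .inr ⟨le_rfl, id⟩
    · exact .inl (.base hx)
  | @step x σ hx hσ _ ih =>
    by_cases hall : ∀ y ∈ σ, Derivable F P y
    · exact .inl (.step hx hσ hall)
    push Not at hall
    obtain ⟨y, hy, hyP⟩ := hall
    obtain ⟨hry, hyr⟩ := (ih y hy).resolve_left hyP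
    have hstar := (hF _ hσ).2
    refine .inr ⟨?_, fun hxP => hyr ?_⟩
    · have := hstar y (.inr hy) (inv x) (.inl rfl) (by rintro rfl; exact hx hy)
      rw [SeparationSystem.inv_inv] at this
      exact hry.trans this
    -- Read the same star with `y` as its outgoing edge: `inv y` follows from `inv x` and the other
    -- members. No other member `z` needs `r`, since otherwise `r ≤ y ≤ inv z ≤ inv r`.
    · refine .of_insert (σ := insert (inv x) σ) ?_ ?_
      · rw [SeparationSystem.inv_inv, Set.insert_eq_of_mem (Set.mem_insert_of_mem _ hy)]
        exact hσ
      · rintro z (rfl | hz) hzy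
        · exact hxP
        · rw [SeparationSystem.inv_inv] at hzy
          refine (ih z hz).resolve_right fun hz' => hr ?_
          have := hstar y (.inr hy) z (.inr hz) hzy.symm
          exact hry.trans (this.trans ((inv_le_inv _ _).2 hz'.1))

/-- A separation whose addition makes an irreconcilable set reconcilable has a derivable
inverse. -/
theorem Irreconcilable.derivable_inv (hF : ∀ σ ∈ F, IsStar σ) (hP : Irreconcilable F P) {r : U}
    (hsmall : r ≤ inv r → Derivable F P r) (hr : ¬ Irreconcilable F (insert r P)) :
    Derivable F P (inv r) := by
  simp only [Irreconcilable, not_forall, not_not] at hr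
  obtain ⟨x, hx, hx'⟩ := hr
  by_cases hrP : Derivable F P r
  · have h : ∀ y ∈ insert r P, Derivable F P y := by
      rintro y (rfl | hy)
      · exact hrP
      · exact .base hy
    exact (hP x (hx.trans h) (hx'.trans h)).elim
  have hsm : ¬ r ≤ inv r := fun h => hrP (hsmall h)
  rcases hx.reroot hF hsm with h1 | ⟨h1, h1'⟩ <;> rcases hx'.reroot hF hsm with h2 | ⟨h2, h2'⟩
  · exact (hP x h1 h2).elim
  · exact h2' (by rwa [SeparationSystem.inv_inv])
  · exact h1' h2
  -- If both derivations need `r`, then `r ≤ x` and `r ≤ inv x`, hence `r ≤ inv r`.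
  · exact (hsm (h1.trans (le_inv_comm.1 h2))).elim

/-- Tangle-tree duality: if no tree over `F` exists, in the sense that no separation and its
inverse are both derivable, then there is an `F`-tangle. -/
theorem exists_isTangle [Finite U] (hS : ∀ s ∈ S, inv s ∈ S)
    (hF : ∀ σ ∈ F, σ ⊆ S ∧ IsStar σ) (hsmall : ∀ r ∈ S, r ≤ inv r → {inv r} ∈ F)
    (hsep : ∀ P, IsDownClosed S P → ∀ r s, r ≤ s → Derivable F P (inv r) → Derivable F P s →
      ∃ t, Derivable F P t ∧ Derivable F P (inv t))
    (h0 : Irreconcilable F (∅ : Set U)) : ∃ O, IsTangle S F O := by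
  obtain ⟨P, ⟨hPd, hPi⟩, hmax⟩ := (Set.toFinite
    {P : Set U | IsDownClosed S P ∧ Irreconcilable F P}).exists_maximal
      ⟨∅, ⟨Set.empty_subset _, by simp⟩, h0⟩
  -- A minimal `r ≤ s` outside `P` can be added without losing down-closure, so maximality of `P`
  -- makes the enlarged set reconcilable.
  have key : ∀ s ∈ S, s ∉ P → ∃ r ≤ s, Derivable F P (inv r) := by
    intro s hs hsP
    obtain ⟨r, ⟨hrS, hrs, hrP⟩, hmin⟩ := (Set.toFinite
      {r : U | r ∈ S ∧ r ≤ s ∧ r ∉ P}).exists_minimal ⟨s, hs, le_rfl, hsP⟩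
    refine ⟨r, hrs, hPi.derivable_inv (fun σ hσ => (hF σ hσ).2) (fun h => ?_) fun hi => ?_⟩
    · exact .of_insert (σ := ∅) (by simpa using hsmall r hrS h) (by simp)
    · refine hrP (hmax ⟨⟨Set.insert_subset hrS hPd.1, ?_⟩, hi⟩ (Set.subset_insert _ _)
        (Set.mem_insert r P))
      rintro q hq t (rfl | ht) hqt
      · by_cases hqP : q ∈ P
        · exact .inr hqP
        · exact .inl (le_antisymm hqt (hmin ⟨hq, hqt.trans hrs, hqP⟩ hqt))
      · exact .inr (hPd.2 q hq t ht hqt)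
  have hanti : ∀ r, r ∈ P → inv r ∉ P := fun r hr hr' => hPi r (.base hr) (.base hr')
  refine ⟨P, ⟨hPd.1, fun s hs => ?_⟩, ?_, fun σ hσ hσP => ?_⟩
  · by_cases hsP : s ∈ P
    · exact ⟨s, ⟨hsP, .inl rfl⟩, fun y hy => hy.2.resolve_right
        (by rintro rfl; exact hanti s hsP hy.1)⟩
    by_cases hsP' : inv s ∈ P
    · exact ⟨inv s, ⟨hsP', .inr rfl⟩, fun y hy => hy.2.resolve_left
        (by rintro rfl; exact hsP hy.1)⟩
    obtain ⟨r, hrs, hr⟩ := key s hs hsP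
    obtain ⟨r', hrs', hr'⟩ := key _ (hS s hs) hsP'
    -- If `P` misses both orientations of `s`, then `r ≤ s ≤ inv r'` with `inv r` and `inv r'`
    -- derivable.
    obtain ⟨t, ht, ht'⟩ := hsep P hPd r (inv r') (hrs.trans (le_inv_comm.1 hrs')) hr hr'
    exact (hPi t ht ht').elim
  · rintro ⟨r, hr, s, -, -, -, hrs, hr', hs'⟩
    exact hanti r (hPd.2 r hr s hs' hrs.le) hr'
  · obtain ⟨r, hr⟩ := (hF σ hσ).2.1
    refine hPi r (.base (hσP hr)) (.of_insert (σ := σ) ?_ fun y hy _ => .base (hσP hy))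
    rwa [SeparationSystem.inv_inv, Set.insert_eq_of_mem hr]

/-- A finite tree cannot be oriented with an edge leaving every node. -/
theorem exists_mutual_of_isTree {N : Type*} [Finite N] {T : SimpleGraph N} (hT : T.IsTree)
    (f : N → N) (hf : ∀ t, T.Adj t (f t)) : ∃ t, f (f t) = t := by
  classical
  have := Fintype.ofFinite N
  have hcard := hT.card_edgeFinset
  -- A tree has one edge fewer than nodes, so two nodes choose the same edge.
  obtain ⟨a, -, b, -, hab, h⟩ := Finset.exists_ne_map_eq_of_card_lt_of_maps_to
    (s := Finset.univ) (t := T.edgeFinset) (f := fun t => s(t, f t))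
    (by rw [Finset.card_univ]; omega) (fun t _ => by simpa using hf t)
  rcases Sym2.eq_iff.1 h with ⟨h, -⟩ | ⟨h1, h2⟩
  · exact (hab h).elim
  · exact ⟨a, by rw [h2, ← h1]⟩

/-- An `S`-tree over `F` rules out any orientation of `S` that avoids `F`. -/
theorem STree.not_avoids (τ : STree S) (hτ : τ.IsOver F) {O : Set U} (hO : IsOrientation S O) :
    ¬ Avoids F O := by
  intro hav
  have := τ.finite_nodes
  have hout : ∀ t, ∃ x, ∃ h : τ.tree.Adj x t, τ.α ⟨(x, t), h⟩ ∉ O := by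
    intro t
    by_contra! hcon
    refine hav _ (hτ t) ?_
    rintro _ ⟨⟨⟨x, y⟩, h⟩, rfl, rfl⟩
    exact hcon x h
  choose f hf hfO using hout
  obtain ⟨t, ht⟩ := exists_mutual_of_isTree τ.isTree f fun t => (hf t).symm
  obtain ⟨y, ⟨hyO, hy⟩, -⟩ := hO.2 _ (τ.α_mem ⟨(f t, t), hf t⟩)
  rcases hy with rfl | rfl
  · exact hfO t hyO
  · rw [← τ.α_symm] at hyO
    refine hfO (f t) ?_
    convert hyO using 2
    simp [SimpleGraph.Dart.symm, ht]

end Abstract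

/-! ### Submodularity and shifting of vertex separations. -/

section Separations

open SeparationSystem hiding inv_inv

variable {V : Type*} {G : SimpleGraph V}

@[simp] theorem VertexSep.inv_A (s : VertexSep G) : (inv s).A = s.B := rfl

@[simp] theorem VertexSep.inv_B (s : VertexSep G) : (inv s).B = s.A := rfl

@[simp] theorem VertexSep.order_inv (s : VertexSep G) : (inv s).order = s.order := by
  simp [VertexSep.order, Set.inter_comm]

instance VertexSep.instFinite [Finite V] : Finite (VertexSep G) :=
  Finite.of_injective (fun s : VertexSep G => (s.A, s.B)) fun s t h => by
    simp only [Prod.mk.injEq] at h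
    exact VertexSep.ext h.1 h.2

theorem VertexSep.mem_or (s : VertexSep G) (v : V) : v ∈ s.A ∨ v ∈ s.B := by
  rw [← Set.mem_union, s.union_eq]; trivial

theorem VertexSep.mem_of_adj (s : VertexSep G) {a b : V} (h : G.Adj a b) :
    (a ∈ s.A ∧ b ∈ s.A) ∨ (a ∈ s.B ∧ b ∈ s.B) := by
  have h1 := s.not_adj a
  have h2 := s.not_adj b
  have h3 := s.mem_or a
  have h4 := s.mem_or b
  by_contra hcon
  have := h.symm
  simp only [Set.mem_sdiff] at h1 h2
  grind

/-- The separation `(A, B)`, where no vertex and no edge is left uncovered. -/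
def VertexSep.ofCover (A B : Set V) (h : ∀ v, v ∈ A ∨ v ∈ B)
    (hadj : ∀ a b, G.Adj a b → (a ∈ A ∧ b ∈ A) ∨ (a ∈ B ∧ b ∈ B)) : VertexSep G where
  A := A
  B := B
  union_eq := by ext v; simpa using h v
  not_adj a ha b hb hab := by
    rcases hadj a b hab with h | h
    · exact hb.2 h.2
    · exact ha.2 h.1

/-- The infimum of two separations. -/
def VertexSep.inf (r s : VertexSep G) : VertexSep G :=
  .ofCover (r.A ∩ s.A) (r.B ∪ s.B)
    (fun v => by have := r.mem_or v; have := s.mem_or v; grind)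
    (fun a b h => by have := r.mem_of_adj h; have := s.mem_of_adj h; grind)

/-- The supremum of two separations. -/
def VertexSep.sup (r s : VertexSep G) : VertexSep G := inv ((inv r).inf (inv s))

@[simp] theorem VertexSep.inf_A (r s : VertexSep G) : (r.inf s).A = r.A ∩ s.A := rfl

@[simp] theorem VertexSep.inf_B (r s : VertexSep G) : (r.inf s).B = r.B ∪ s.B := rfl

@[simp] theorem VertexSep.sup_A (r s : VertexSep G) : (r.sup s).A = r.A ∪ s.A := rfl

@[simp] theorem VertexSep.sup_B (r s : VertexSep G) : (r.sup s).B = r.B ∩ s.B := rfl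

variable [Finite V]

/-- The order of separations is submodular (in fact modular). -/
theorem VertexSep.order_inf_add_order_sup (r s : VertexSep G) :
    (r.inf s).order + (r.sup s).order = r.order + s.order := by
  simp only [VertexSep.order]
  rw [← Set.ncard_union_add_ncard_inter, ← Set.ncard_union_add_ncard_inter (r.A ∩ r.B)]
  congr 2 <;>
  · ext v
    have := r.mem_or v
    have := s.mem_or v
    simp only [inf_A, inf_B, sup_A, sup_B, Set.mem_union, Set.mem_inter_iff]
    tauto

/-- Replacing `x` by its infimum with `r` does not increase the order if `r` has minimum order
among the separations between `r` and some `s ≥ x`. -/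
theorem VertexSep.order_inf_le {r s x : VertexSep G} (hrs : r ≤ s)
    (hmin : ∀ t, r ≤ t → t ≤ s → r.order ≤ t.order) (hxA : x.A ⊆ s.A) (hxB : s.B ⊆ x.B) :
    (r.inf x).order ≤ x.order := by
  have h1 := r.order_inf_add_order_sup x
  have h2 := hmin (r.sup x) ⟨Set.subset_union_left, Set.inter_subset_left⟩
    ⟨Set.union_subset hrs.1 hxA, Set.subset_inter hrs.2 hxB⟩
  omega

variable {w k : ℕ} {P : Set (VertexSep G)}

/-- The shift `y ↦ r.inf y` raises no order below `s`, by `order_inf_le`. The size of the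
intersection is controlled by the same inequality, applied to an auxiliary separation. -/
theorem mem_starsLT_insert_inf {r s x : VertexSep G} {σ : Set (VertexSep G)} (hrs : r ≤ s)
    (hmin : ∀ t, r ≤ t → t ≤ s → r.order ≤ t.order) (hxs : x ≤ s) (hx : inv x ∉ σ)
    (hσ : insert (inv x) σ ∈ starsLT G w k) :
    insert (inv (r.inf x)) (r.inf '' σ) ∈ starsLT G w k := by
  obtain ⟨hk, ⟨-, hst⟩, hw⟩ := hσ
  have hle : ∀ y ∈ σ, y ≤ x := fun y hy => by
    simpa [SeparationSystem.inv_inv] using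
      hst y (.inr hy) (inv x) (.inl rfl) (by rintro rfl; exact hx hy)
  refine ⟨?_, ⟨Set.insert_nonempty _ _, ?_⟩, ?_⟩
  · rintro _ (rfl | ⟨y, hy, rfl⟩)
    · have := hk (Set.mem_insert _ _)
      simp only [sepsLT, Set.mem_ofPred_eq, VertexSep.order_inv] at this ⊢
      exact (VertexSep.order_inf_le hrs hmin hxs.1 hxs.2).trans_lt this
    · have hys := (hle y hy).trans hxs
      exact (VertexSep.order_inf_le hrs hmin hys.1 hys.2).trans_lt (hk (.inr hy))
  · have hmono : ∀ y ∈ σ, r.inf y ≤ r.inf x := fun y hy =>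
      ⟨Set.inter_subset_inter_right _ (hle y hy).1, Set.union_subset_union_right _ (hle y hy).2⟩
    rintro _ (rfl | ⟨y, hy, rfl⟩) _ (rfl | ⟨z, hz, rfl⟩) hne
    · exact (hne rfl).elim
    · exact (inv_le_inv _ _).2 (hmono z hz)
    · rw [SeparationSystem.inv_inv]
      exact hmono y hy
    · have := hst y (.inr hy) z (.inr hz) (by rintro rfl; exact hne rfl)
      refine ⟨fun v hv => .inr (this.1 hv.2), fun v hv => .inr (this.2 hv.2)⟩
  · have hX : (⋂ y ∈ insert (inv x) σ, y.B) = x.A ∩ ⋂ y ∈ σ, y.B := by simp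
    rw [hX] at hw
    set X := x.A ∩ ⋂ y ∈ σ, y.B with hXdef
    have hcap : x.A ∩ x.B ⊆ X := fun v hv => ⟨hv.1, Set.mem_iInter₂.2 fun y hy => (hle y hy).2 hv.2⟩
    -- Adding `X` to the `B`-side makes `X` the separator, so `x'` has order `X.ncard`. The shifted
    -- star's intersection lies in the separator of `r.inf x'`, whose order is no larger. The order
    -- of `x'` need not be below `k`.
    let x' : VertexSep G := .ofCover x.A (x.B ∪ X)
      (fun v => by have := x.mem_or v; grind)
      (fun a b h => by have := x.mem_of_adj h; grind)
    have hx' : x'.order = X.ncard := by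
      change (x.A ∩ (x.B ∪ X)).ncard = _
      congr 1
      rw [Set.inter_union_distrib_left, Set.inter_eq_right.2 (Set.inter_subset_left : X ⊆ x.A),
        Set.union_eq_right.2 hcap]
    have hord : (r.inf x').order ≤ x'.order :=
      VertexSep.order_inf_le hrs hmin hxs.1 (hxs.2.trans Set.subset_union_left)
    refine lt_of_le_of_lt (Set.ncard_le_ncard ?_ (Set.toFinite _)) ((hx' ▸ hord).trans_lt hw)
    intro v hv
    simp only [Set.mem_iInter, Set.mem_insert_iff, forall_eq_or_imp, VertexSep.inv_B,
      Set.forall_mem_image, VertexSep.inf_A, VertexSep.inf_B] at hv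
    refine ⟨hv.1, ?_⟩
    by_cases hvB : v ∈ r.B
    · exact .inl hvB
    · exact .inr (.inr ⟨hv.1.2, Set.mem_iInter₂.2 fun y hy => (hv.2 hy).resolve_left hvB⟩)

/-- If `r` has minimum order among the separations between `r` and the derivable separation `s`,
then `r` is derivable. -/
theorem Derivable.of_le {r s : VertexSep G} (hP : IsDownClosed (sepsLT G k) P) (hrs : r ≤ s)
    (hmin : ∀ t, r ≤ t → t ≤ s → r.order ≤ t.order) (hs : Derivable (starsLT G w k) P s) :
    Derivable (starsLT G w k) P r := by
  -- The whole derivation is shifted by `r.inf`: leaves stay in `P` by down-closure, and the root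
  -- `s` becomes `r`.
  have key : ∀ x, Derivable (starsLT G w k) P x → x ≤ s →
      Derivable (starsLT G w k) P (r.inf x) := by
    intro x hx
    induction hx with
    | @base x hx =>
      refine fun hxs => .base (hP.2 _ ?_ x hx ⟨Set.inter_subset_right, Set.subset_union_right⟩)
      exact (VertexSep.order_inf_le hrs hmin hxs.1 hxs.2).trans_lt (hP.1 hx)
    | @step x σ hx hσ _ ih =>
      refine fun hxs => .of_insert (mem_starsLT_insert_inf hrs hmin hxs hx hσ) ?_
      rintro _ ⟨y, hy, rfl⟩ -
      refine ih y hy (le_trans ?_ hxs)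
      simpa [SeparationSystem.inv_inv] using
        hσ.2.1.2 y (.inr hy) (inv x) (.inl rfl) (by rintro rfl; exact hx hy)
  have h : r.inf s = r := VertexSep.ext (Set.inter_eq_left.2 hrs.1) (Set.union_eq_left.2 hrs.2)
  simpa [h] using key s hs le_rfl

/-- A `t` of minimum order between `r` and `s` allows two shifts: from `s` down to `t`, and from
`inv r` down to `inv t`. -/
theorem Derivable.exists_between {r s : VertexSep G} (hP : IsDownClosed (sepsLT G k) P)
    (hrs : r ≤ s) (hr : Derivable (starsLT G w k) P (inv r))
    (hs : Derivable (starsLT G w k) P s) :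
    ∃ t, Derivable (starsLT G w k) P t ∧ Derivable (starsLT G w k) P (inv t) := by
  obtain ⟨t, ⟨hrt, hts⟩, hmin⟩ := (Set.toFinite (Set.Icc r s)).exists_minimalFor
    VertexSep.order _ ⟨r, le_rfl, hrs⟩
  have hmin' : ∀ u, r ≤ u → u ≤ s → t.order ≤ u.order := fun u h1 h2 =>
    (le_total t.order u.order).elim id fun h => hmin ⟨h1, h2⟩ h
  refine ⟨t, hs.of_le hP hts fun u h1 h2 => hmin' u (hrt.trans h1) h2,
    hr.of_le hP ((inv_le_inv _ _).2 hrt) fun u h1 h2 => ?_⟩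
  have := hmin' (inv u) (le_inv_comm.1 h2) ((inv_le_inv _ _).1 (by
    rw [SeparationSystem.inv_inv]; exact ((inv_le_inv _ _).2 hts).trans h1))
  simpa using this

theorem exists_isTangle_sepsLT (hw : k ≤ w)
    (h : Irreconcilable (starsLT G w k) (∅ : Set (VertexSep G))) :
    ∃ O, IsTangle (sepsLT G k) (starsLT G w k) O := by
  refine exists_isTangle (fun s hs => ?_) (fun σ hσ => ⟨hσ.1, hσ.2.1⟩) (fun r hr hle => ?_)
    (fun P hP r s => Derivable.exists_between hP) h
  · simpa [sepsLT] using hs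
  · have hr' : r.order < k := hr
    refine ⟨by simpa [sepsLT] using hr', ⟨Set.singleton_nonempty _, ?_⟩, ?_⟩
    · rintro _ rfl _ rfl hne
      exact (hne rfl).elim
    · simp only [Set.mem_singleton_iff, Set.iInter_iInter_eq_left, VertexSep.inv_B]
      -- The order of a small `r` is the size of `r.A`, which is the star intersection here; hence
      -- `k ≤ w` suffices.
      have hAB : r.A ⊆ r.B := hle.1
      rw [VertexSep.order, Set.inter_eq_left.2 hAB] at hr'
      omega

end Separations

/-! ### From derivations to tree-decompositions. -/

section Decompositions

open SeparationSystem hiding inv_inv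

theorem _root_.SimpleGraph.IsTree.sum_sup_edge {M N : Type*} [Finite M] [Finite N]
    {S : SimpleGraph M} {T : SimpleGraph N} (hS : S.IsTree) (hT : T.IsTree) (a : M) (b : N) :
    (S.sum T ⊔ SimpleGraph.edge (.inl a) (.inr b)).IsTree := by
  rw [SimpleGraph.isTree_iff_connected_and_card] at *
  refine ⟨hS.1.sum_sup_edge hT.1, ?_⟩
  have h1 : (S.sum T ⊔ SimpleGraph.edge (.inl a) (.inr b)).edgeSet =
      insert s(.inl a, .inr b) (S.sum T).edgeSet := by
    rw [SimpleGraph.edgeSet_sup, SimpleGraph.edgeSet_edge, Set.union_comm]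
    ext e
    simp +contextual [or_iff_not_imp_left]
  have h2 : Nat.card (S.sum T).edgeSet = Nat.card S.edgeSet + Nat.card T.edgeSet := by
    rw [Nat.card_congr SimpleGraph.edgeSetSumEquiv, Nat.card_sum]
  rw [h1, Nat.card_coe_set_eq, Set.ncard_insert_of_notMem (by simp), ← Nat.card_coe_set_eq, h2,
    Nat.card_sum]
  omega

variable {V : Type*}

/-- A tree-decomposition of the subgraph of `G` induced by `W` into parts of size less than `w`
and with adhesion sets of size less than `k`, with a node `root` whose part contains `R`. -/
structure RootedDecomposition (G : SimpleGraph V) (w k : ℕ) (W R : Set V) where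
  nodes : Type
  finite_nodes : Finite nodes
  tree : SimpleGraph nodes
  isTree : tree.IsTree
  bag : nodes → Set V
  root : nodes
  subset_bag_root : R ⊆ bag root
  bag_subset : ∀ t, bag t ⊆ W
  vertex_mem : ∀ v ∈ W, ∃ t, v ∈ bag t
  edge_mem : ∀ u ∈ W, ∀ v ∈ W, G.Adj u v → ∃ t, u ∈ bag t ∧ v ∈ bag t
  exists_walk : ∀ v t t', v ∈ bag t → v ∈ bag t' →
    ∃ p : tree.Walk t t', ∀ x ∈ p.support, v ∈ bag x
  ncard_bag_lt : ∀ t, (bag t).ncard < w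
  ncard_inter_lt : ∀ t t', tree.Adj t t' → (bag t ∩ bag t').ncard < k

variable {G : SimpleGraph V} {w k : ℕ}

/-- The decomposition into a single part. -/
def RootedDecomposition.single {X : Set V} (hX : X.ncard < w) : RootedDecomposition G w k X X where
  nodes := Unit
  finite_nodes := inferInstance
  tree := ⊥
  isTree := .of_subsingleton
  bag _ := X
  root := ()
  subset_bag_root := subset_rfl
  bag_subset _ := subset_rfl
  vertex_mem _ hv := ⟨(), hv⟩
  edge_mem _ hu _ hv _ := ⟨(), hu, hv⟩
  exists_walk _ _ _ h _ := ⟨.nil, fun _ _ => h⟩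
  ncard_bag_lt _ := hX
  ncard_inter_lt _ _ h := h.elim

/-- Joining the roots of two decompositions by an edge. -/
def RootedDecomposition.join [Finite V] {W₁ W₂ R₁ R₂ : Set V}
    (D₁ : RootedDecomposition G w k W₁ R₁) (D₂ : RootedDecomposition G w k W₂ R₂)
    (h₁ : W₁ ∩ W₂ ⊆ R₁) (h₂ : W₁ ∩ W₂ ⊆ R₂) (hk : (W₁ ∩ W₂).ncard < k)
    (hadj : ∀ u ∈ W₁, ∀ v ∈ W₂, G.Adj u v → u ∈ W₂ ∨ v ∈ W₁) :
    RootedDecomposition G w k (W₁ ∪ W₂) R₁ where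
  nodes := D₁.nodes ⊕ D₂.nodes
  finite_nodes := by
    have := D₁.finite_nodes
    have := D₂.finite_nodes
    infer_instance
  tree := D₁.tree.sum D₂.tree ⊔ SimpleGraph.edge (.inl D₁.root) (.inr D₂.root)
  isTree := by
    have := D₁.finite_nodes
    have := D₂.finite_nodes
    exact D₁.isTree.sum_sup_edge D₂.isTree _ _
  bag := Sum.elim D₁.bag D₂.bag
  root := .inl D₁.root
  subset_bag_root := D₁.subset_bag_root
  bag_subset := by
    rintro (t | t)
    · exact (D₁.bag_subset t).trans Set.subset_union_left
    · exact (D₂.bag_subset t).trans Set.subset_union_right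
  vertex_mem := by
    rintro v (hv | hv)
    · obtain ⟨t, ht⟩ := D₁.vertex_mem v hv
      exact ⟨.inl t, ht⟩
    · obtain ⟨t, ht⟩ := D₂.vertex_mem v hv
      exact ⟨.inr t, ht⟩
  edge_mem := by
    have e₁ : ∀ u ∈ W₁, ∀ v ∈ W₁, G.Adj u v →
        ∃ t, u ∈ Sum.elim D₁.bag D₂.bag t ∧ v ∈ Sum.elim D₁.bag D₂.bag t := fun u hu v hv h => by
      obtain ⟨t, ht⟩ := D₁.edge_mem u hu v hv h
      exact ⟨.inl t, ht⟩
    have e₂ : ∀ u ∈ W₂, ∀ v ∈ W₂, G.Adj u v →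
        ∃ t, u ∈ Sum.elim D₁.bag D₂.bag t ∧ v ∈ Sum.elim D₁.bag D₂.bag t := fun u hu v hv h => by
      obtain ⟨t, ht⟩ := D₂.edge_mem u hu v hv h
      exact ⟨.inr t, ht⟩
    rintro u (hu | hu) v (hv | hv) h
    · exact e₁ u hu v hv h
    · rcases hadj u hu v hv h with h' | h'
      · exact e₂ u h' v hv h
      · exact e₁ u hu v h' h
    · rcases hadj v hv u hu h.symm with h' | h'
      · exact e₂ u hu v h' h
      · exact e₁ u h' v hv h
    · exact e₂ u hu v hv h
  exists_walk := by
    have w₁ : ∀ v t t', v ∈ D₁.bag t → v ∈ D₁.bag t' →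
        ∃ p : (D₁.tree.sum D₂.tree ⊔ SimpleGraph.edge (.inl D₁.root) (.inr D₂.root)).Walk
          (.inl t) (.inl t'), ∀ x ∈ p.support, v ∈ Sum.elim D₁.bag D₂.bag x := by
      intro v t t' ht ht'
      obtain ⟨p, hp⟩ := D₁.exists_walk v t t' ht ht'
      let f := (SimpleGraph.Hom.ofLE (le_sup_left (b := SimpleGraph.edge (.inl D₁.root)
        (.inr D₂.root)))).comp (SimpleGraph.Embedding.sumInl (G := D₁.tree) (H := D₂.tree)).toHom
      refine ⟨p.map f, fun x hx => ?_⟩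
      obtain ⟨y, hy, rfl⟩ := List.mem_map.1 (p.support_map f ▸ hx)
      exact hp y hy
    have w₂ : ∀ v t t', v ∈ D₂.bag t → v ∈ D₂.bag t' →
        ∃ p : (D₁.tree.sum D₂.tree ⊔ SimpleGraph.edge (.inl D₁.root) (.inr D₂.root)).Walk
          (.inr t) (.inr t'), ∀ x ∈ p.support, v ∈ Sum.elim D₁.bag D₂.bag x := by
      intro v t t' ht ht'
      obtain ⟨p, hp⟩ := D₂.exists_walk v t t' ht ht'
      let f := (SimpleGraph.Hom.ofLE (le_sup_left (b := SimpleGraph.edge (.inl D₁.root)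
        (.inr D₂.root)))).comp (SimpleGraph.Embedding.sumInr (G := D₁.tree) (H := D₂.tree)).toHom
      refine ⟨p.map f, fun x hx => ?_⟩
      obtain ⟨y, hy, rfl⟩ := List.mem_map.1 (p.support_map f ▸ hx)
      exact hp y hy
    have w₁₂ : ∀ v t t', v ∈ D₁.bag t → v ∈ D₂.bag t' →
        ∃ p : (D₁.tree.sum D₂.tree ⊔ SimpleGraph.edge (.inl D₁.root) (.inr D₂.root)).Walk
          (.inl t) (.inr t'), ∀ x ∈ p.support, v ∈ Sum.elim D₁.bag D₂.bag x := by
      intro v t t' ht ht'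
      have hv : v ∈ W₁ ∩ W₂ := ⟨D₁.bag_subset t ht, D₂.bag_subset t' ht'⟩
      obtain ⟨p, hp⟩ := w₁ v t D₁.root ht (D₁.subset_bag_root (h₁ hv))
      obtain ⟨q, hq⟩ := w₂ v D₂.root t' (D₂.subset_bag_root (h₂ hv)) ht'
      have hab : (D₁.tree.sum D₂.tree ⊔ SimpleGraph.edge (.inl D₁.root) (.inr D₂.root)).Adj
        (.inl D₁.root) (.inr D₂.root) := by simp [SimpleGraph.edge]
      refine ⟨p.append (.cons hab q), fun x hx => ?_⟩
      rw [SimpleGraph.Walk.mem_support_append_iff, SimpleGraph.Walk.support_cons,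
        List.mem_cons] at hx
      rcases hx with hx | rfl | hx
      · exact hp x hx
      · exact hp _ p.end_mem_support
      · exact hq x hx
    rintro v (t | t) (t' | t') ht ht'
    · exact w₁ v t t' ht ht'
    · exact w₁₂ v t t' ht ht'
    · obtain ⟨p, hp⟩ := w₁₂ v t' t ht' ht
      exact ⟨p.reverse, by simpa using hp⟩
    · exact w₂ v t t' ht ht'
  ncard_bag_lt := by
    rintro (t | t)
    · exact D₁.ncard_bag_lt t
    · exact D₂.ncard_bag_lt t
  ncard_inter_lt := by
    have h₁₂ : ∀ t t', (D₁.bag t ∩ D₂.bag t').ncard < k := fun t t' =>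
      (Set.ncard_le_ncard (Set.inter_subset_inter (D₁.bag_subset t) (D₂.bag_subset t'))
        (Set.toFinite _)).trans_lt hk
    rintro (t | t) (t' | t') h
    · exact D₁.ncard_inter_lt t t' (by simpa [SimpleGraph.edge] using h)
    · exact h₁₂ t t'
    · simpa only [Sum.elim_inl, Sum.elim_inr, Set.inter_comm] using h₁₂ t' t
    · exact D₂.ncard_inter_lt t t' (by simpa [SimpleGraph.edge] using h)

/-- A decomposition of the whole graph into more than one part is a tree-decomposition of small
width and adhesion. -/
theorem RootedDecomposition.exists_treeDecomposition {W R : Set V}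
    (D : RootedDecomposition G w k W R) (hW : W = Set.univ) (hD : Nontrivial D.nodes)
    (hk : 0 < k) : ∃ D : TreeDecomposition G, Nontrivial D.nodes ∧ D.width < (w : ℤ) - 1 ∧
      D.adhesion < k := by
  have hw : 0 < w := (Nat.zero_le _).trans_lt (D.ncard_bag_lt D.root)
  subst hW
  refine ⟨⟨D.nodes, D.finite_nodes, D.tree, D.isTree, D.bag, fun v => D.vertex_mem v trivial,
    fun u v => D.edge_mem u trivial v trivial, ?_⟩, hD, ?_, ?_⟩
  · rintro t₁ t₃ p hp t₂ ht₂ v ⟨h₁, h₃⟩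
    classical
    obtain ⟨q, hq⟩ := D.exists_walk v t₁ t₃ h₁ h₃
    -- In a tree, the only path is obtained by shortcutting any walk, so a walk inside the parts
    -- containing `v` suffices.
    have : p = q.bypass := (D.isTree.existsUnique_path t₁ t₃).unique hp q.bypass_isPath
    exact hq t₂ (q.support_bypass_subset_support (this ▸ ht₂))
  · have : (⨆ t, (D.bag t).ncard) ≤ w - 1 :=
      ciSup_le' fun t => Nat.le_sub_one_of_lt (D.ncard_bag_lt t)
    simp only [TreeDecomposition.width]
    omega
  · have : (⨆ e : D.tree.Dart, (D.bag e.fst ∩ D.bag e.snd).ncard) ≤ k - 1 :=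
      ciSup_le' fun e => Nat.le_sub_one_of_lt (D.ncard_inter_lt _ _ e.adj)
    rw [TreeDecomposition.adhesion, if_neg (not_subsingleton_iff_nontrivial.2 hD)]
    exact this.trans_lt (by omega)

/-- A derivation of `x` from nothing yields a decomposition of its `A`-side. -/
theorem Derivable.nonempty_rootedDecomposition [Finite V] {x : VertexSep G}
    (h : Derivable (starsLT G w k) ∅ x) :
    Nonempty (RootedDecomposition G w k x.A (x.A ∩ x.B)) := by
  induction h with
  | base hx => exact hx.elim
  | @step x σ hx hσ _ ih =>
    obtain ⟨hk, ⟨-, hst⟩, hw⟩ := hσ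
    have hle : ∀ y ∈ σ, y ≤ x := fun y hy => by
      simpa [SeparationSystem.inv_inv] using
        hst y (.inr hy) (inv x) (.inl rfl) (by rintro rfl; exact hx hy)
    have hX : (⋂ y ∈ insert (inv x) σ, y.B) = x.A ∩ ⋂ y ∈ σ, y.B := by simp
    rw [hX] at hw
    set X := x.A ∩ ⋂ y ∈ σ, y.B with hXdef
    have hyX : ∀ y ∈ σ, y.A ∩ y.B ⊆ X := by
      refine fun y hy v hv => ⟨(hle y hy).1 hv.1, Set.mem_iInter₂.2 fun z hz => ?_⟩
      by_cases hyz : y = z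
      · exact hyz ▸ hv.2
      · exact (hst y (.inr hy) z (.inr hz) hyz).1 hv.1
    -- Starting from the central part `X`, the decompositions of the sides `y.A` are attached one by
    -- one. By the star property everything built so far lies in `y.B`, so the overlap is within the
    -- separator of `y`, which both roots contain.
    have key : ∀ τ ⊆ σ, Nonempty (RootedDecomposition G w k (X ∪ ⋃ y ∈ τ, y.A) X) := by
      intro τ
      induction τ, Set.toFinite τ using Set.Finite.induction_on with
      | empty => exact fun _ => ⟨by simpa using RootedDecomposition.single hw⟩
      | @insert y τ hyτ _ ih' =>
        intro hτ
        obtain ⟨D₁⟩ := ih' ((Set.subset_insert _ _).trans hτ)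
        have hy : y ∈ σ := hτ (Set.mem_insert _ _)
        obtain ⟨D₂⟩ := ih y hy
        have hsub : (X ∪ ⋃ z ∈ τ, z.A) ⊆ y.B := by
          refine Set.union_subset (fun v hv => Set.mem_iInter₂.1 hv.2 y hy)
            (Set.iUnion₂_subset fun z hz => ?_)
          exact (hst z (.inr (hτ (.inr hz))) y (.inr hy) (by rintro rfl; exact hyτ hz)).1
        have hcap : (X ∪ ⋃ z ∈ τ, z.A) ∩ y.A ⊆ y.A ∩ y.B := fun v hv => ⟨hv.2, hsub hv.1⟩
        have hunion : (X ∪ ⋃ z ∈ insert y τ, z.A) = (X ∪ ⋃ z ∈ τ, z.A) ∪ y.A := by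
          rw [Set.biUnion_insert, Set.union_assoc, Set.union_comm y.A]
        rw [hunion]
        refine ⟨D₁.join D₂ (hcap.trans (hyX y hy)) hcap
          ((Set.ncard_le_ncard hcap (Set.toFinite _)).trans_lt (hk (.inr hy))) ?_⟩
        intro u hu v hv huv
        rcases y.mem_of_adj huv with h | h
        · exact .inl h.1
        · exact .inr (.inl (hyX y hy ⟨hv, h.2⟩))
    obtain ⟨D⟩ := key σ subset_rfl
    have hA : (X ∪ ⋃ y ∈ σ, y.A) = x.A := by
      refine Set.Subset.antisymm (Set.union_subset Set.inter_subset_left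
        (Set.iUnion₂_subset fun y hy => (hle y hy).1)) fun v hv => ?_
      by_cases hcon : ∃ y ∈ σ, v ∈ y.A
      · exact .inr (by simpa using hcon)
      · push Not at hcon
        exact .inl ⟨hv, Set.mem_iInter₂.2 fun y hy => (y.mem_or v).resolve_left (hcon y hy)⟩
    rw [hA] at D
    refine ⟨{ D with subset_bag_root := Set.Subset.trans (fun v hv => ?_) D.subset_bag_root }⟩
    exact ⟨hv.1, Set.mem_iInter₂.2 fun y hy => (hle y hy).2 hv.2⟩

/-- If a separation and its inverse are derivable, there is a tree-decomposition. -/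
theorem exists_treeDecomposition_of_derivable [Finite V] (hk : 0 < k) {x : VertexSep G}
    (h : Derivable (starsLT G w k) ∅ x) (h' : Derivable (starsLT G w k) ∅ (inv x)) :
    ∃ D : TreeDecomposition G, Nontrivial D.nodes ∧ D.width < (w : ℤ) - 1 ∧ D.adhesion < k := by
  have hx : x ∈ sepsLT G k := h.mem (fun σ hσ => hσ.1)
    (fun s hs => by simpa [sepsLT] using hs) (Set.empty_subset _)
  obtain ⟨D₁⟩ := h.nonempty_rootedDecomposition
  obtain ⟨D₂⟩ := h'.nonempty_rootedDecomposition
  refine (D₁.join D₂ subset_rfl (Set.inter_comm _ _).subset hx fun u hu v hv huv => ?_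
    ).exists_treeDecomposition x.union_eq ?_ hk
  · rcases x.mem_of_adj huv with h | h
    · exact .inr h.2
    · exact .inl h.1
  · exact ⟨.inl D₁.root, .inr D₂.root, nofun⟩

end Decompositions

/-! ### From tree-decompositions to `S_k`-trees. -/

section SeparationTrees

open SeparationSystem hiding inv_inv

section Side

variable {N : Type*} {T : SimpleGraph N}

/-- The nodes on the side of `x` of the edge `xy`. -/
def side (T : SimpleGraph N) (x y : N) : Set N :=
  {t | (T.deleteEdges {s(x, y)}).Reachable t x}

theorem mem_side_self (x y : N) : x ∈ side T x y := SimpleGraph.Reachable.refl x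

theorem mem_side_or (hT : T.IsTree) (x y t : N) : t ∈ side T x y ∨ t ∈ side T y x := by
  by_contra! hcon
  obtain ⟨hx, hy⟩ := hcon
  obtain ⟨p⟩ := hT.connected.preconnected t x
  obtain ⟨d, -, h₁, h₂⟩ := p.exists_boundary_dart
    {u | (T.deleteEdges {s(x, y)}).Reachable t u} (SimpleGraph.Reachable.refl t) hx
  by_cases hd : s(d.fst, d.snd) = s(x, y)
  · rcases Sym2.eq_iff.1 hd with ⟨h, -⟩ | ⟨h, -⟩
    · exact hx (h ▸ h₁)
    · exact hy (by rw [side, Sym2.eq_swap]; exact h ▸ h₁)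
  · exact h₂ (h₁.trans (SimpleGraph.Adj.reachable
      (SimpleGraph.deleteEdges_adj.2 ⟨d.adj, by simpa using hd⟩)))

theorem notMem_side_symm (hT : T.IsTree) {x y t : N} (h : T.Adj x y) (ht : t ∈ side T x y) :
    t ∉ side T y x := by
  intro ht'
  rw [side, Sym2.eq_swap] at ht'
  exact SimpleGraph.isBridge_iff.1
    (SimpleGraph.isAcyclic_iff_forall_adj_isBridge.1 hT.isAcyclic h) (ht.symm.trans ht')

theorem mem_edges_of_mem_side (hT : T.IsTree) {x y s t : N} (h : T.Adj x y)
    (hs : s ∈ side T x y) (ht : t ∈ side T y x) (p : T.Walk s t) : s(x, y) ∈ p.edges := by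
  refine p.mem_edges_of_not_reachable_deleteEdges fun hst => ?_
  exact notMem_side_symm hT h (hst.symm.trans hs) ht

/-- A node behind both `x` and `y` would reach `x` while avoiding `xt`; crossing `yt` on the way,
that walk would connect `t` to `x` without the bridge `xt`. This makes the edge separations at a
node a star. -/
theorem side_subset_side (hT : T.IsTree) {x y t : N} (hx : T.Adj x t) (hy : T.Adj y t)
    (hxy : x ≠ y) : side T x t ⊆ side T t y := by
  classical
  intro s hs
  refine (mem_side_or hT t y s).resolve_right fun hsy => ?_
  obtain ⟨q⟩ := hs
  have hq := mem_edges_of_mem_side hT hy hsy ((mem_side_or hT t y x).resolve_right ?_)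
    (q.mapLe (SimpleGraph.deleteEdges_le _))
  · have ht := SimpleGraph.Walk.snd_mem_support_of_mem_edges _ hq
    rw [SimpleGraph.Walk.support_mapLe_eq_support] at ht
    exact notMem_side_symm hT hx (x := x) (y := t) (t := t) ⟨q.dropUntil t ht⟩ (mem_side_self t x)
  · intro hxs
    have := mem_edges_of_mem_side hT hy hxs (mem_side_self t y) (.cons hx .nil)
    simp only [SimpleGraph.Walk.edges_cons, SimpleGraph.Walk.edges_nil, List.mem_singleton] at this
    rcases Sym2.eq_iff.1 this with ⟨h, -⟩ | ⟨h, -⟩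
    · exact hxy h.symm
    · exact hy.ne h

theorem exists_adj_mem_side (hT : T.IsTree) {s t : N} (hst : s ≠ t) :
    ∃ x, T.Adj x t ∧ s ∈ side T x t := by
  obtain ⟨p, hp⟩ := hT.connected.exists_isPath t s
  cases p with
  | nil => exact (hst rfl).elim
  | @cons _ x _ h q =>
    refine ⟨x, h.symm, ?_⟩
    refine (mem_side_or hT x t s).resolve_right fun hs => ?_
    have := mem_edges_of_mem_side hT h hs (mem_side_self x t) q.reverse
    rw [SimpleGraph.Walk.edges_reverse, List.mem_reverse] at this
    exact ((SimpleGraph.Walk.cons_isPath_iff _ _).1 hp).2 (q.fst_mem_support_of_mem_edges this)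

end Side

variable {V : Type*} {G : SimpleGraph V}

namespace TreeDecomposition

variable (D : TreeDecomposition G)

/-- The union of the parts on the side of `x` of the edge `xy`. -/
def sideUnion (x y : D.nodes) : Set V := ⋃ t ∈ side D.tree x y, D.bag t

variable {D}

theorem mem_sideUnion {x y : D.nodes} {v : V} :
    v ∈ D.sideUnion x y ↔ ∃ t ∈ side D.tree x y, v ∈ D.bag t := by
  simp [sideUnion]

theorem sideUnion_inter_sideUnion {x y : D.nodes} (h : D.tree.Adj x y) :
    D.sideUnion x y ∩ D.sideUnion y x ⊆ D.bag x ∩ D.bag y := by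
  rintro v ⟨hv, hv'⟩
  obtain ⟨s, hs, hvs⟩ := mem_sideUnion.1 hv
  obtain ⟨t, ht, hvt⟩ := mem_sideUnion.1 hv'
  obtain ⟨p, hp⟩ := D.isTree.connected.exists_isPath s t
  have he := mem_edges_of_mem_side D.isTree h hs ht p
  exact ⟨D.path_inter s t p hp x (p.fst_mem_support_of_mem_edges he) ⟨hvs, hvt⟩,
    D.path_inter s t p hp y (p.snd_mem_support_of_mem_edges he) ⟨hvs, hvt⟩⟩

/-- The separation of `G` that corresponds to an oriented edge of the decomposition tree. -/
def sep (e : D.tree.Dart) : VertexSep G :=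
  .ofCover (D.sideUnion e.fst e.snd) (D.sideUnion e.snd e.fst)
    (fun v => by
      obtain ⟨t, ht⟩ := D.vertex_mem v
      exact (mem_side_or D.isTree e.fst e.snd t).imp (fun h => mem_sideUnion.2 ⟨t, h, ht⟩)
        (fun h => mem_sideUnion.2 ⟨t, h, ht⟩))
    (fun a b hab => by
      obtain ⟨t, ha, hb⟩ := D.edge_mem a b hab
      exact (mem_side_or D.isTree e.fst e.snd t).imp
        (fun h => ⟨mem_sideUnion.2 ⟨t, h, ha⟩, mem_sideUnion.2 ⟨t, h, hb⟩⟩)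
        (fun h => ⟨mem_sideUnion.2 ⟨t, h, ha⟩, mem_sideUnion.2 ⟨t, h, hb⟩⟩))

/-- A vertex missing from the part at `t` has a part behind some neighbour `x`. If it also lay in
the `B`-side for `x`, it would be in both side unions, hence in the part at `t`. -/
theorem biInter_sep_B_subset_bag (t : D.nodes) :
    (⋂ s ∈ sep '' {e : D.tree.Dart | e.snd = t}, s.B) ⊆ D.bag t := by
  intro v hv
  simp only [Set.mem_iInter, Set.forall_mem_image] at hv
  by_contra hvt
  obtain ⟨s, hs⟩ := D.vertex_mem v
  have hst : s ≠ t := by rintro rfl; exact hvt hs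
  obtain ⟨x, hx, hsx⟩ := exists_adj_mem_side D.isTree hst
  have hvB : v ∈ D.sideUnion t x := hv (x := ⟨(x, t), hx⟩) rfl
  exact hvt (sideUnion_inter_sideUnion hx ⟨mem_sideUnion.2 ⟨s, hsx, hs⟩, hvB⟩).2

theorem ncard_bag_lt {w : ℕ} (hD : D.width < (w : ℤ) - 1) (t : D.nodes) : (D.bag t).ncard < w := by
  have := D.finite_nodes
  have h := le_ciSup (f := fun t => (D.bag t).ncard) (Set.finite_range _).bddAbove t
  simp only [width] at hD
  omega

variable [Finite V] {w k : ℕ}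

theorem sep_mem_sepsLT (hD : D.adhesion < k) (e : D.tree.Dart) : sep e ∈ sepsLT G k := by
  have := D.finite_nodes
  have : Finite D.tree.Dart := Finite.of_injective _ SimpleGraph.Dart.toProd_injective
  have h := le_ciSup (f := fun e : D.tree.Dart => (D.bag e.fst ∩ D.bag e.snd).ncard)
    (Set.finite_range _).bddAbove e
  rw [adhesion, if_neg (not_subsingleton_iff_nontrivial.2 ⟨e.fst, e.snd, e.adj.ne⟩)] at hD
  exact ((Set.ncard_le_ncard (sideUnion_inter_sideUnion e.adj) (Set.toFinite _)).trans h).trans_lt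
    hD

/-- A tree-decomposition with at least two nodes of small width and adhesion gives rise to an
`S_k`-tree. -/
theorem exists_sTree (hN : Nontrivial D.nodes) (hw : D.width < (w : ℤ) - 1)
    (hk : D.adhesion < k) : ∃ τ : STree (sepsLT G k), τ.IsOver (starsLT G w k) := by
  refine ⟨⟨D.nodes, D.finite_nodes, D.tree, D.isTree, ?_, sep, sep_mem_sepsLT hk, fun e => rfl⟩,
    fun t => ⟨?_, ⟨?_, ?_⟩, ?_⟩⟩
  · obtain ⟨s, t, hst⟩ := hN
    obtain ⟨x, hx, -⟩ := exists_adj_mem_side D.isTree hst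
    exact ⟨s(x, t), hx⟩
  · rintro _ ⟨e, -, rfl⟩
    exact sep_mem_sepsLT hk e
  · obtain ⟨s, hs⟩ := exists_ne t
    obtain ⟨x, hx, -⟩ := exists_adj_mem_side D.isTree hs
    exact ⟨_, ⟨(x, t), hx⟩, rfl, rfl⟩
  · have key : ∀ x y, D.tree.Adj x t → D.tree.Adj y t → x ≠ y →
        D.sideUnion x t ⊆ D.sideUnion t y := fun x y hx hy hxy =>
      Set.biUnion_subset_biUnion_left (side_subset_side D.isTree hx hy hxy)
    rintro _ ⟨⟨⟨x, _⟩, hx⟩, rfl, rfl⟩ _ ⟨⟨⟨y, z⟩, hy⟩, hz, rfl⟩ hne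
    change z = _ at hz
    subst hz
    have hxy : x ≠ y := by rintro rfl; exact hne rfl
    exact ⟨key x y hx hy hxy, key y x hy hx hxy.symm⟩
  · exact (Set.ncard_le_ncard (biInter_sep_B_subset_bag t) (Set.toFinite _)).trans_lt
      (ncard_bag_lt hw t)

end TreeDecomposition

/-- A graph with a tree-decomposition of small width and adhesion has one with at least two
nodes. -/
theorem TreeDecomposition.exists_nontrivial [Finite V] {w k : ℕ} (hk : 0 < k) (hkw : k ≤ w)
    (D : TreeDecomposition G) (hw : D.width < (w : ℤ) - 1) (hD : D.adhesion < k) :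
    ∃ D : TreeDecomposition G, Nontrivial D.nodes ∧ D.width < (w : ℤ) - 1 ∧ D.adhesion < k := by
  by_cases hN : Subsingleton D.nodes
  swap
  · exact ⟨D, not_subsingleton_iff_nontrivial.1 hN, hw, hD⟩
  -- With one node the adhesion is `|V|` by convention, so `|V| < k ≤ w` and two adjacent copies of
  -- the full vertex set are admissible.
  rw [adhesion, if_pos hN, ← Set.ncard_univ] at hD
  let D₁ := RootedDecomposition.single (G := G) (k := k) (hD.trans_le hkw)
  exact (D₁.join D₁ (Set.subset_univ _) (Set.subset_univ _) (by simpa using hD)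
    fun _ _ _ _ _ => .inl trivial).exists_treeDecomposition (Set.union_self _)
    ⟨.inl D₁.root, .inr D₁.root, nofun⟩ hk

end SeparationTrees

end TreeDuality

theorem mainTheorem8 {V : Type*} [Finite V] [Nonempty V] (G : SimpleGraph V) (w k : ℕ)
    (hk : 0 < k) (hw : k ≤ w) :
    List.TFAE
      [∃ O : Set (TreeDuality.VertexSep G),
          TreeDuality.IsTangle (TreeDuality.sepsLT G k) (TreeDuality.starsLT G w k) O,
        ¬ ∃ τ : TreeDuality.STree (TreeDuality.sepsLT G k),
          τ.IsOver (TreeDuality.starsLT G w k),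
        ¬ ∃ D : TreeDuality.TreeDecomposition G,
          D.width < (w : ℤ) - 1 ∧ D.adhesion < k] := by
  tfae_have 1 → 2 := by
    rintro ⟨O, hO, -, hav⟩ ⟨τ, hτ⟩
    exact τ.not_avoids hτ hO hav
  tfae_have 2 → 3 := by
    rintro h ⟨D, hD, hD'⟩
    obtain ⟨D', hN, h₁, h₂⟩ := D.exists_nontrivial hk hw hD hD'
    exact h (TreeDuality.TreeDecomposition.exists_sTree hN h₁ h₂)
  tfae_have 3 → 1 := fun h => TreeDuality.exists_isTangle_sepsLT hw fun x hx hx' =>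
    have ⟨D, _, hD⟩ := TreeDuality.exists_treeDecomposition_of_derivable hk hx hx'
    h ⟨D, hD⟩
  tfae_finish
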